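/- Let $d\ge 1$, let $M_d$ be the algebra of complex $d\times d$ matrices, $M_d^+$ the cone of positive semi-definite matrices and $\mathcal R_d=\{\rho\in M_d^+:\operatorname{Tr}\rho=1\}$ the set of states. Let $\mathcal S\subseteq M_d$ be an operator system, that is, a linear subspace with $I\in\mathcal S$ and $A^*\in\mathcal S$ whenever $A\in\mathcal S$. An orthonormal family $v_1,\dots,v_k\in\mathbb C^d$ is $\mathcal S$-independent if $v_iv_j^*$ is orthogonal to $\mathcal S$ in the Hilbert–Schmidt inner product for all $i\neq j$; an orthogonal projection is $\mathcal S$-abelian if its range is the span of an $\mathcal S$-independent family. Write $\mathcal P_{\rm a}(\mathcal S)$ for the set of $\mathcal S$-abelian projections. A convex corner is a non-empty closed convex set $\mathcal A\subseteq M_d^+$ such that $B\in\mathcal A$ and $0\le A\le B$ imply $A\in\mathcal A$; let ${\rm ap}(\mathcal S)$ be the smallest convex corner containing $\mathcal P_{\rm a}(\mathcal S)$. For $\rho\in\mathcal R_d$ and $A=\sum_{i=1}^d\lambda_iu_iu_i^*\in M_d^+$, with $(u_i)$ an orthonormal basis of $\mathbb C^d$, put $-\operatorname{Tr}(\rho\log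 A)=-\sum_{i}\langle\rho u_i,u_i\rangle\log\lambda_i$ (terms with $\lambda_i=0$ being zero) if $\ker A\subseteq\ker\rho$, and $-\operatorname{Tr}(\rho\log A)=+\infty$ otherwise. The non-commutative graph entropy is $$H(\mathcal S,\rho)=H_{{\rm ap}(\mathcal S)}(\rho)=\min_{A\in{\rm ap}(\mathcal S)}-\operatorname{Tr}(\rho\log A),$$ and the fractional chromatic number is $$\chi_{\rm f}(\mathcal S)=\inf\Big\{\sum_{i=1}^k\lambda_i:\ k\in\mathbb N,\ \lambda_i>0,\ P_1,\dots,P_k\in\mathcal P_{\rm a}(\mathcal S),\ \sum_{i=1}^k\lambda_iP_i\ge I\Big\}.$$ Then the minimum defining $H(\mathcal S,\rho)$ is attained for every $\rho\in\mathcal R_d$, the function $\rho\mapsto H(\mathcal S,\rho)$ attains its maximum on $\mathcal R_d$, and $$\max_{\rho\in\mathcal R_d}H(\mathcal S,\rho)=\log\chi_{\rm f}(\mathcal S).$$ -/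

import Mathlib

namespace NCGraph

open scoped ComplexOrder

/-- The set `M_d^+` of positive (semi-definite) matrices. -/
def posCone (d : ℕ) : Set (Matrix (Fin d) (Fin d) ℂ) :=
  {A | A.PosSemidef}

/-- The set `R_d` of states: positive matrices of trace one. -/
def states (d : ℕ) : Set (Matrix (Fin d) (Fin d) ℂ) :=
  {ρ | ρ.PosSemidef ∧ ρ.trace = 1}

/-- An operator system (non-commutative graph): a linear subspace of `M_d` that contains the
identity and is closed under taking adjoints. -/
structure IsOperatorSystem {d : ℕ} (S : Submodule ℂ (Matrix (Fin d) (Fin d) ℂ)) : Prop where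
  one_mem : (1 : Matrix (Fin d) (Fin d) ℂ) ∈ S
  conjTranspose_mem : ∀ A ∈ S, A.conjTranspose ∈ S

/-- A convex corner in `M_d`: a non-empty, closed, convex, hereditary set of positive matrices. -/
structure IsConvexCorner {d : ℕ} (𝒜 : Set (Matrix (Fin d) (Fin d) ℂ)) : Prop where
  subset_posCone : 𝒜 ⊆ posCone d
  nonempty : 𝒜.Nonempty
  isClosed : IsClosed 𝒜
  convex : Convex ℝ 𝒜
  hereditary : ∀ A B : Matrix (Fin d) (Fin d) ℂ,
    B ∈ 𝒜 → A.PosSemidef → (B - A).PosSemidef → A ∈ 𝒜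

/-- The convex corner `C(𝒢)` generated by `𝒢`: the intersection of all convex corners
containing `𝒢`. -/
def cornerHull {d : ℕ} (𝒢 : Set (Matrix (Fin d) (Fin d) ℂ)) : Set (Matrix (Fin d) (Fin d) ℂ) :=
  ⋂₀ {𝒜 | IsConvexCorner 𝒜 ∧ 𝒢 ⊆ 𝒜}

/-- The rank one operator `u v^*`. -/
def rankOne {d : ℕ} (u v : EuclideanSpace ℂ (Fin d)) : Matrix (Fin d) (Fin d) ℂ :=
  Matrix.vecMulVec (WithLp.ofLp u) (star (WithLp.ofLp v))

/-- An `S`-independent family: it is orthonormal, and `v_i v_j^*` is orthogonal to `S` in the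
Hilbert-Schmidt inner product whenever `i ≠ j`. -/
def IsIndependentFamily {d k : ℕ} (S : Submodule ℂ (Matrix (Fin d) (Fin d) ℂ))
    (v : Fin k → EuclideanSpace ℂ (Fin d)) : Prop :=
  Orthonormal ℂ v ∧
    ∀ i j, i ≠ j → ∀ A ∈ S, ((rankOne (v i) (v j)).conjTranspose * A).trace = 0

/-- The set `P_a(S)` of `S`-abelian projections: orthogonal projections whose range is the span
of an `S`-independent family. -/
def abelianProjections {d : ℕ} (S : Submodule ℂ (Matrix (Fin d) (Fin d) ℂ)) :
    Set (Matrix (Fin d) (Fin d) ℂ) :=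
  {P | IsStarProjection P ∧ ∃ (k : ℕ) (v : Fin k → EuclideanSpace ℂ (Fin d)),
    IsIndependentFamily S v ∧
      LinearMap.range (Matrix.toEuclideanLin P) = Submodule.span ℂ (Set.range v)}

/-- The abelian projection corner `ap(S) = C(P_a(S))`. -/
def abelianProjectionCorner {d : ℕ} (S : Submodule ℂ (Matrix (Fin d) (Fin d) ℂ)) :
    Set (Matrix (Fin d) (Fin d) ℂ) :=
  cornerHull (abelianProjections S)

open Classical in
/-- The extended real number `- Tr (ρ log A)` for positive `ρ` and `A`. If `ker A ⊆ ker ρ`, it is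
computed on the eigenvectors of `A` (the eigenvectors with eigenvalue `0` contribute `0`, and
`Real.log 0 = 0`); otherwise it is `+∞`. -/
noncomputable def negTraceMulLog {d : ℕ} (ρ A : Matrix (Fin d) (Fin d) ℂ) : EReal :=
  if LinearMap.ker A.mulVecLin ≤ LinearMap.ker ρ.mulVecLin then
    ((-(ρ * cfc Real.log A).trace.re : ℝ) : EReal)
  else ⊤

/-- The entropy `H_𝒜(ρ)` of `ρ` over `𝒜`: the least value of `- Tr (ρ log A)` for `A ∈ 𝒜`, taken
as an infimum in the extended real line. -/
noncomputable def cornerEntropy {d : ℕ} (𝒜 : Set (Matrix (Fin d) (Fin d) ℂ))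
    (ρ : Matrix (Fin d) (Fin d) ℂ) : EReal :=
  ⨅ A ∈ 𝒜, negTraceMulLog ρ A

/-- The non-commutative graph entropy `H(S, ρ) = H_{ap(S)}(ρ)`. -/
noncomputable def graphEntropy {d : ℕ} (S : Submodule ℂ (Matrix (Fin d) (Fin d) ℂ))
    (ρ : Matrix (Fin d) (Fin d) ℂ) : EReal :=
  cornerEntropy (abelianProjectionCorner S) ρ

/-- The total weights of the fractional colourings of `S`: numbers `∑ λ_i` with `λ_i > 0` and
`∑ λ_i P_i ≥ I` for some `S`-abelian projections `P_i`. -/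
def fractionalColouringWeights {d : ℕ} (S : Submodule ℂ (Matrix (Fin d) (Fin d) ℂ)) : Set ℝ :=
  {t | ∃ (k : ℕ) (c : Fin k → ℝ) (P : Fin k → Matrix (Fin d) (Fin d) ℂ),
    (∀ i, 0 < c i) ∧ (∀ i, P i ∈ abelianProjections S) ∧
      (∑ i, c i • P i - 1).PosSemidef ∧ t = ∑ i, c i}

/-- The fractional chromatic number `χ_f(S)`. -/
noncomputable def fractionalChromaticNumber {d : ℕ}
    (S : Submodule ℂ (Matrix (Fin d) (Fin d) ℂ)) : ℝ :=
  sInf (fractionalColouringWeights S)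

/-- Positive matrices form a convex corner, so that `cornerHull` is an intersection over a
non-empty family. -/
theorem isConvexCorner_posCone (d : ℕ) : IsConvexCorner (posCone d) where
  subset_posCone := subset_rfl
  nonempty := ⟨0, Matrix.PosSemidef.zero⟩
  isClosed := by
    have : posCone d = {A | A.conjTranspose = A} ∩
        ⋂ x : Fin d → ℂ, {A | 0 ≤ star x ⬝ᵥ (A.mulVec x)} := by
      ext A
      simp only [posCone, Set.mem_ofPred_eq, Set.mem_inter_iff, Set.mem_iInter,
        Matrix.posSemidef_iff_dotProduct_mulVec, Matrix.IsHermitian]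
    rw [this]
    refine (isClosed_eq (by fun_prop) continuous_id).inter (isClosed_iInter fun x => ?_)
    exact isClosed_le continuous_const (by fun_prop)
  convex := by
    intro A hA B hB a b ha hb _
    exact (Matrix.PosSemidef.smul hA ha).add (Matrix.PosSemidef.smul hB hb)
  hereditary := fun _ _ _ hA _ => hA

theorem isConvexCorner_cornerHull {d : ℕ} {𝒢 : Set (Matrix (Fin d) (Fin d) ℂ)}
    (h𝒢 : 𝒢 ⊆ posCone d) : IsConvexCorner (cornerHull 𝒢) where
  subset_posCone := Set.sInter_subset_of_mem ⟨isConvexCorner_posCone d, h𝒢⟩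
  nonempty := by
    refine ⟨0, fun 𝒜 h𝒜 => ?_⟩
    obtain ⟨B, hB⟩ := h𝒜.1.nonempty
    exact h𝒜.1.hereditary 0 B hB Matrix.PosSemidef.zero
      (by rw [sub_zero]; exact h𝒜.1.subset_posCone hB)
  isClosed := isClosed_sInter fun 𝒜 h𝒜 => h𝒜.1.isClosed
  convex := convex_sInter fun 𝒜 h𝒜 => h𝒜.1.convex
  hereditary := fun A B hB hA hAB 𝒜 h𝒜 => h𝒜.1.hereditary A B (hB 𝒜 h𝒜) hA hAB

/-- The `S`-abelian projections are positive, so `ap(S)` is a convex corner. -/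
theorem isConvexCorner_abelianProjectionCorner {d : ℕ}
    (S : Submodule ℂ (Matrix (Fin d) (Fin d) ℂ)) :
    IsConvexCorner (abelianProjectionCorner S) := by
  refine isConvexCorner_cornerHull ?_
  rintro P ⟨hP, -⟩
  have h : P = P.conjTranspose * P := by
    rw [← Matrix.star_eq_conjTranspose, hP.isSelfAdjoint.star_eq, hP.isIdempotentElem.eq]
  change P.PosSemidef
  rw [h]
  exact Matrix.posSemidef_conjTranspose_mul_self P

/-- Every rank one projection is `S`-abelian. -/
theorem rankOne_mem_abelianProjections {d : ℕ} (S : Submodule ℂ (Matrix (Fin d) (Fin d) ℂ))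
    (u : EuclideanSpace ℂ (Fin d)) (hu : ‖u‖ = 1) : rankOne u u ∈ abelianProjections S := by
  have key : star (WithLp.ofLp u) ⬝ᵥ WithLp.ofLp u = 1 := by
    have h : inner ℂ u u = (1 : ℂ) := by
      rw [inner_self_eq_norm_sq_to_K, hu]; simp
    rw [EuclideanSpace.inner_eq_star_dotProduct] at h
    rwa [dotProduct_comm]
  have hlin : ∀ x : EuclideanSpace ℂ (Fin d),
      Matrix.toEuclideanLin (rankOne u u) x = (star (WithLp.ofLp u) ⬝ᵥ WithLp.ofLp x) • u := by
    intro x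
    ext i
    simp [rankOne, Matrix.vecMulVec_mulVec, mul_comm]
  refine ⟨⟨?_, ?_⟩, 1, fun _ => u, ⟨?_, ?_⟩, ?_⟩
  · have h : star (WithLp.ofLp u) ⬝ᵥ WithLp.ofLp u = 1 := key
    simp [IsIdempotentElem, rankOne, Matrix.vecMulVec_mul_vecMulVec, h]
  · simp [IsSelfAdjoint, rankOne, Matrix.star_eq_conjTranspose, Matrix.conjTranspose_vecMulVec]
  · exact ⟨fun _ => hu, fun i j hij => absurd (Subsingleton.elim i j) hij⟩
  · exact fun i j hij => absurd (Subsingleton.elim i j) hij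
  · rw [Set.range_const]
    ext x
    rw [Submodule.mem_span_singleton]
    constructor
    · rintro ⟨y, rfl⟩
      exact ⟨_, (hlin y).symm⟩
    · rintro ⟨a, rfl⟩
      refine ⟨a • u, ?_⟩
      rw [map_smul, hlin u]
      have h : star (WithLp.ofLp u) ⬝ᵥ WithLp.ofLp u = 1 := key
      rw [h, one_smul]

/-- The infimum defining `χ_f(S)` is over a non-empty set of reals ... -/
theorem fractionalColouringWeights_nonempty {d : ℕ}
    (S : Submodule ℂ (Matrix (Fin d) (Fin d) ℂ)) : (fractionalColouringWeights S).Nonempty := by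
  refine ⟨_, d, fun _ => 1,
    fun i => rankOne (EuclideanSpace.single i 1) (EuclideanSpace.single i 1),
    fun _ => one_pos, fun i => rankOne_mem_abelianProjections S _ (by simp), ?_, rfl⟩
  have : (∑ i : Fin d, (1 : ℝ) • rankOne (EuclideanSpace.single i (1 : ℂ))
      (EuclideanSpace.single i 1)) = 1 := by
    ext a b
    simp [rankOne, Matrix.sum_apply, Matrix.vecMulVec_apply, Matrix.one_apply, Pi.single_apply]
  rw [this, sub_self]
  exact Matrix.PosSemidef.zero

/-- ... that is bounded below. -/
theorem fractionalColouringWeights_bddBelow {d : ℕ}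
    (S : Submodule ℂ (Matrix (Fin d) (Fin d) ℂ)) : BddBelow (fractionalColouringWeights S) := by
  refine ⟨0, ?_⟩
  rintro t ⟨k, c, P, hc, -, -, rfl⟩
  exact Finset.sum_nonneg fun i _ => (hc i).le

end NCGraph

/-! Upper bound: if `∑ c_i P_i ≥ I` has total weight `t`, dividing by `t` gives a convex combination
of abelian projections above `t⁻¹ I`. So `t⁻¹ I` lies in the corner, and its entropy is `log t` in
every state.

Lower bound: Sion's minimax theorem for `Tr(ρA)`, with `ρ` a state and `A` in the closed convex hull
of the abelian projections, gives a state `ρ` and a value `s` (`exists_state_dual`). On one side,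
`Tr(ρP) ≤ s` for all abelian `P`; this bound cuts out a convex corner, so it holds on all of
`ap(S)`, and Jensen's inequality gives `-Tr(ρ log A) ≥ -log s` there. On the other, for each `t < s`
the hull contains some `A ≥ t I`, which for `t > 0` is a fractional colouring of weight `t⁻¹`; hence
`s ≤ 1/χ_f`.

The minimum is attained because `-Tr(ρ log A)` is lower semicontinuous in `A`, as a supremum of
continuous regularisations, and `ap(S)` is compact. -/

namespace NCGraph

open scoped ComplexOrder

/-! ### Traces against functions of `A` as sums over an eigenbasis -/

section EigenWeight

variable {d : ℕ} {ρ A : Matrix (Fin d) (Fin d) ℂ}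

/-- The diagonal entry `⟨ρ u_i, u_i⟩` of `ρ` in an orthonormal eigenbasis `(u_i)` of `A`. -/
noncomputable def eigenWeight (ρ : Matrix (Fin d) (Fin d) ℂ) (hA : A.IsHermitian)
    (i : Fin d) : ℝ :=
  ((star (hA.eigenvectorUnitary : Matrix (Fin d) (Fin d) ℂ) * ρ *
    (hA.eigenvectorUnitary : Matrix (Fin d) (Fin d) ℂ)) i i).re

theorem trace_mul_cfc_re (hA : A.IsHermitian) (f : ℝ → ℝ) :
    (ρ * cfc f A).trace.re = ∑ i, eigenWeight ρ hA i * f (hA.eigenvalues i) := by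
  rw [hA.cfc_eq f, Matrix.IsHermitian.cfc, Unitary.conjStarAlgAut_apply, ← mul_assoc, ← mul_assoc,
    Matrix.trace_mul_comm, ← mul_assoc, ← mul_assoc, Matrix.trace, Complex.re_sum]
  refine Finset.sum_congr rfl fun i _ => ?_
  rw [Matrix.diag_apply, Matrix.mul_diagonal]
  simp [eigenWeight]

theorem sum_eigenWeight (hA : A.IsHermitian) : ∑ i, eigenWeight ρ hA i = ρ.trace.re := by
  have h := trace_mul_cfc_re (ρ := ρ) hA (fun _ => 1)
  rw [cfc_const_one ℝ A hA.isSelfAdjoint] at h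
  simpa using h.symm

theorem sum_eigenWeight_mul_eigenvalues (hA : A.IsHermitian) :
    ∑ i, eigenWeight ρ hA i * hA.eigenvalues i = (ρ * A).trace.re := by
  have h := trace_mul_cfc_re (ρ := ρ) hA id
  rw [cfc_id ℝ A hA.isSelfAdjoint] at h
  simpa using h.symm

theorem posSemidef_conj_eigenvectorUnitary (hρ : ρ.PosSemidef) (hA : A.IsHermitian) :
    (star (hA.eigenvectorUnitary : Matrix (Fin d) (Fin d) ℂ) * ρ *
      (hA.eigenvectorUnitary : Matrix (Fin d) (Fin d) ℂ)).PosSemidef :=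
  hρ.conjTranspose_mul_mul_same _

theorem eigenWeight_nonneg (hρ : ρ.PosSemidef) (hA : A.IsHermitian) (i : Fin d) :
    0 ≤ eigenWeight ρ hA i :=
  (Complex.le_def.1 ((posSemidef_conj_eigenvectorUnitary hρ hA).diag_nonneg (i := i))).1

theorem conj_eigenvectorUnitary_apply (hA : A.IsHermitian) (i : Fin d) :
    (star (hA.eigenvectorUnitary : Matrix (Fin d) (Fin d) ℂ) * ρ *
      (hA.eigenvectorUnitary : Matrix (Fin d) (Fin d) ℂ)) i i =
    star (WithLp.ofLp (hA.eigenvectorBasis i)) ⬝ᵥ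
      ρ.mulVec (WithLp.ofLp (hA.eigenvectorBasis i)) := by
  rw [mul_assoc]
  rfl

/-- `ker A` is spanned by the eigenvectors of eigenvalue zero, and for positive `ρ` the equality
`⟨ρu, u⟩ = 0` already forces `ρu = 0`. -/
theorem ker_le_ker_iff_eigenWeight_eq_zero (hρ : ρ.PosSemidef) (hA : A.IsHermitian) :
    LinearMap.ker A.mulVecLin ≤ LinearMap.ker ρ.mulVecLin ↔
      ∀ i, hA.eigenvalues i = 0 → eigenWeight ρ hA i = 0 := by
  constructor
  · intro h i hi
    have h1 : ρ.mulVec (WithLp.ofLp (hA.eigenvectorBasis i)) = 0 := by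
      refine h (x := WithLp.ofLp (hA.eigenvectorBasis i)) ?_
      simp [hA.mulVec_eigenvectorBasis i, hi]
    rw [eigenWeight, conj_eigenvectorUnitary_apply, h1]
    simp
  · intro h x hx
    have hx' : A.mulVec x = 0 := hx
    have hz : ∀ i, hA.eigenvalues i = 0 → ρ.mulVec (WithLp.ofLp (hA.eigenvectorBasis i)) = 0 := by
      intro i hi
      rw [← hρ.dotProduct_mulVec_zero_iff, ← conj_eigenvectorUnitary_apply]
      have h1 := (posSemidef_conj_eigenvectorUnitary hρ hA).diag_nonneg (i := i)
      exact Complex.ext (h i hi) (Complex.le_def.1 h1).2.symm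
    have hrep := hA.eigenvectorBasis.sum_repr (WithLp.toLp 2 x)
    have hrep' : x = ∑ i, (hA.eigenvectorBasis.repr (WithLp.toLp 2 x) i) •
        WithLp.ofLp (hA.eigenvectorBasis i) := by
      conv_lhs => rw [← WithLp.ofLp_toLp 2 x, ← hrep]
      simp
    have hAx : ∑ i, (hA.eigenvalues i * hA.eigenvectorBasis.repr (WithLp.toLp 2 x) i : ℂ) •
        hA.eigenvectorBasis i = 0 := by
      apply (WithLp.ofLp_injective 2)
      rw [hrep'] at hx'
      simp only [Matrix.mulVec_sum, Matrix.mulVec_smul, hA.mulVec_eigenvectorBasis] at hx'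
      simp only [WithLp.ofLp_sum, WithLp.ofLp_smul, WithLp.ofLp_zero]
      rw [← hx']
      refine Finset.sum_congr rfl fun i _ => ?_
      ext j
      simp; ring
    have hcoef : ∀ i, (hA.eigenvalues i * hA.eigenvectorBasis.repr (WithLp.toLp 2 x) i : ℂ) = 0 :=
      fun i => Fintype.linearIndependent_iff.1
        hA.eigenvectorBasis.orthonormal.linearIndependent _ hAx i
    change ρ.mulVec x = 0
    rw [hrep']
    simp only [Matrix.mulVec_sum, Matrix.mulVec_smul]
    refine Finset.sum_eq_zero fun i _ => ?_
    rcases mul_eq_zero.1 (hcoef i) with h0 | h0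
    · rw [hz i (by exact_mod_cast h0), smul_zero]
    · rw [h0, zero_smul]

theorem negTraceMulLog_of_ker_le (hA : A.IsHermitian)
    (h : LinearMap.ker A.mulVecLin ≤ LinearMap.ker ρ.mulVecLin) :
    negTraceMulLog ρ A =
      ((-∑ i, eigenWeight ρ hA i * Real.log (hA.eigenvalues i) : ℝ) : EReal) := by
  rw [negTraceMulLog, if_pos h, trace_mul_cfc_re hA]

/-- A form of Jensen's inequality for the logarithm. -/
theorem neg_log_le_negTraceMulLog (hρ : ρ ∈ states d) (hA : A.PosSemidef) {s : ℝ} (hs : 0 < s)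
    (h : (ρ * A).trace.re ≤ s) : ((-Real.log s : ℝ) : EReal) ≤ negTraceMulLog ρ A := by
  by_cases hker : LinearMap.ker A.mulVecLin ≤ LinearMap.ker ρ.mulVecLin
  swap
  · rw [negTraceMulLog, if_neg hker]; exact le_top
  rw [negTraceMulLog_of_ker_le hA.1 hker, EReal.coe_le_coe_iff, neg_le_neg_iff]
  have hz := (ker_le_ker_iff_eigenWeight_eq_zero hρ.1 hA.1).1 hker
  -- The tangent line of `log` at `s`. A zero eigenvalue carries zero weight by `hz`, so the default
  -- `Real.log 0 = 0` is harmless.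
  have hterm : ∀ i, eigenWeight ρ hA.1 i * Real.log (hA.1.eigenvalues i) ≤
      eigenWeight ρ hA.1 i * (Real.log s - 1) +
        eigenWeight ρ hA.1 i * hA.1.eigenvalues i * s⁻¹ := by
    intro i
    rcases (hA.eigenvalues_nonneg i).eq_or_lt with h0 | h0
    · simp [hz i h0.symm]
    · have h1 := Real.log_le_sub_one_of_pos (div_pos h0 hs)
      rw [Real.log_div h0.ne' hs.ne'] at h1
      have h2 := mul_le_mul_of_nonneg_left h1 (eigenWeight_nonneg hρ.1 hA.1 i)
      rw [div_eq_mul_inv] at h2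
      linarith
  have h1 : ρ.trace.re = 1 := by rw [hρ.2]; simp
  calc _ ≤ _ := Finset.sum_le_sum fun i _ => hterm i
    _ = (Real.log s - 1) + (ρ * A).trace.re * s⁻¹ := by
      rw [Finset.sum_add_distrib, ← Finset.sum_mul, ← Finset.sum_mul, sum_eigenWeight,
        sum_eigenWeight_mul_eigenvalues, h1, one_mul]
    _ ≤ (Real.log s - 1) + s * s⁻¹ := by gcongr
    _ = Real.log s := by rw [mul_inv_cancel₀ hs.ne']; ring

end EigenWeight

/-! ### Lower semicontinuity of `-Tr(ρ log A)` in `A` -/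

section Semicontinuity

open Filter Topology
open scoped MatrixOrder Matrix.Norms.L2Operator

variable {d : ℕ} {ρ A : Matrix (Fin d) (Fin d) ℂ}

/-- The regularisation `- Tr (ρ log (A + ε))` of `- Tr (ρ log A)`. -/
noncomputable def regNegTraceMulLog (ε : ℝ) (ρ A : Matrix (Fin d) (Fin d) ℂ) : ℝ :=
  -(ρ * cfc (fun x => Real.log (x + ε)) A).trace.re

theorem spectrum_subset_Icc (h0 : 0 ≤ A) (h1 : A ≤ 1) : spectrum ℝ A ⊆ Set.Icc 0 1 := by
  intro x hx
  refine ⟨spectrum_nonneg_of_nonneg h0 hx, (le_abs_self x).trans ?_⟩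
  have hA : IsSelfAdjoint A := IsSelfAdjoint.of_nonneg h0
  exact (IsometricContinuousFunctionalCalculus.norm_spectrum_le A hx hA).trans
    ((CStarAlgebra.norm_le_one_iff_of_nonneg A h0).mpr h1)

theorem continuousOn_regNegTraceMulLog {ε : ℝ} (hε : 0 < ε) :
    ContinuousOn (regNegTraceMulLog ε ρ) (Set.Icc 0 1) := by
  have h : ContinuousOn (fun A : Matrix (Fin d) (Fin d) ℂ => cfc (fun x => Real.log (x + ε)) A)
      (Set.Icc 0 1) := by
    refine ContinuousOn.cfc' (isCompact_Icc (a := (0 : ℝ)) (b := 1)) _ continuousOn_id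
      (fun A hA => spectrum_subset_Icc hA.1 hA.2) (fun A hA => IsSelfAdjoint.of_nonneg hA.1) ?_
    refine ContinuousOn.log (by fun_prop) fun x hx => ?_
    have := hx.1
    positivity
  unfold regNegTraceMulLog
  have h2 : Continuous fun B : Matrix (Fin d) (Fin d) ℂ => -(ρ * B).trace.re := by fun_prop
  exact h2.comp_continuousOn h

/-- Each `-log(λ + ε)` increases to `-log λ` as `ε` decreases to `0`. The kernel condition decides
whether some `λ = 0` has positive weight, which makes the supremum infinite. -/
theorem negTraceMulLog_eq_iSup (hρ : ρ.PosSemidef) (hA : A.PosSemidef) :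
    negTraceMulLog ρ A = ⨆ ε : Set.Ioi (0 : ℝ), (regNegTraceMulLog (ε : ℝ) ρ A : EReal) := by
  have hreg : ∀ ε, regNegTraceMulLog ε ρ A =
      ∑ i, eigenWeight ρ hA.1 i * -Real.log (hA.1.eigenvalues i + ε) := fun ε => by
    rw [regNegTraceMulLog, trace_mul_cfc_re hA.1]; simp
  have hw := eigenWeight_nonneg hρ hA.1
  have hl := hA.eigenvalues_nonneg
  by_cases hker : LinearMap.ker A.mulVecLin ≤ LinearMap.ker ρ.mulVecLin
  · have hz := (ker_le_ker_iff_eigenWeight_eq_zero hρ hA.1).1 hker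
    rw [negTraceMulLog_of_ker_le hA.1 hker]
    apply le_antisymm
    · have ht : Tendsto (fun ε => regNegTraceMulLog ε ρ A) (𝓝[>] 0)
          (𝓝 (-∑ i, eigenWeight ρ hA.1 i * Real.log (hA.1.eigenvalues i))) := by
        simp only [hreg, ← Finset.sum_neg_distrib, ← mul_neg]
        refine tendsto_finsetSum _ fun i _ => ?_
        by_cases h0 : hA.1.eigenvalues i = 0
        · simp [hz i h0]
        · refine (Tendsto.neg ?_).const_mul _
          refine Tendsto.log ?_ h0
          refine tendsto_nhdsWithin_of_tendsto_nhds ?_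
          simpa using (tendsto_const_nhds (x := hA.1.eigenvalues i)).add (tendsto_id (x := 𝓝 0))
      refine le_of_tendsto ((continuous_coe_real_ereal.tendsto _).comp ht) ?_
      filter_upwards [self_mem_nhdsWithin] with ε hε
      exact le_iSup (fun ε : Set.Ioi (0 : ℝ) => (regNegTraceMulLog (ε : ℝ) ρ A : EReal)) ⟨ε, hε⟩
    · refine iSup_le fun ⟨ε, hε⟩ => ?_
      have hε : 0 < ε := hε
      rw [EReal.coe_le_coe_iff, hreg, ← Finset.sum_neg_distrib]
      refine Finset.sum_le_sum fun i _ => ?_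
      rcases (hl i).eq_or_lt with h0 | h0
      · simp [hz i h0.symm]
      · rw [← mul_neg]
        refine mul_le_mul_of_nonneg_left (neg_le_neg (Real.log_le_log h0 (by linarith))) (hw i)
  · rw [negTraceMulLog, if_neg hker]
    rw [ker_le_ker_iff_eigenWeight_eq_zero hρ hA.1] at hker
    push Not at hker
    obtain ⟨j, hj0, hj⟩ := hker
    have hjpos : 0 < eigenWeight ρ hA.1 j := (hw j).lt_of_ne' hj
    have ht : Tendsto (fun ε => regNegTraceMulLog ε ρ A) (𝓝[>] 0) atTop := by
      -- The term at `j` diverges; for `ε < 1` the others are bounded below by their values at `ε =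
      -- 1`.
      have h1 : Tendsto (fun ε : ℝ => eigenWeight ρ hA.1 j * -Real.log ε +
          ∑ i ∈ Finset.univ.erase j, eigenWeight ρ hA.1 i * -Real.log (hA.1.eigenvalues i + 1))
          (𝓝[>] 0) atTop :=
        tendsto_atTop_add_const_right _ _
          ((tendsto_neg_atBot_atTop.comp Real.tendsto_log_nhdsGT_zero).const_mul_atTop hjpos)
      refine tendsto_atTop_mono' _ ?_ h1
      filter_upwards [Ioo_mem_nhdsGT (zero_lt_one' ℝ)] with ε hε
      rw [hreg, ← Finset.add_sum_erase _ _ (Finset.mem_univ j), hj0, zero_add]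
      gcongr with i
      · exact hw i
      · linarith [hl i, hε.1]
      · exact hε.2.le
    symm
    rw [EReal.eq_top_iff_forall_lt]
    intro c
    obtain ⟨ε, hε, hc⟩ := ((ht.eventually_gt_atTop c).and self_mem_nhdsWithin).exists
    exact lt_of_lt_of_le (EReal.coe_lt_coe_iff.2 hε)
      (le_iSup (fun ε : Set.Ioi (0 : ℝ) => (regNegTraceMulLog (ε : ℝ) ρ A : EReal)) ⟨ε, hc⟩)

theorem lowerSemicontinuousOn_negTraceMulLog (hρ : ρ.PosSemidef) :
    LowerSemicontinuousOn (negTraceMulLog ρ) (Set.Icc 0 1) := by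
  have h : LowerSemicontinuousOn (fun A : Matrix (Fin d) (Fin d) ℂ =>
      ⨆ ε : Set.Ioi (0 : ℝ), (regNegTraceMulLog (ε : ℝ) ρ A : EReal)) (Set.Icc 0 1) :=
    lowerSemicontinuousOn_iSup fun ε =>
      (continuous_coe_real_ereal.comp_continuousOn
        (continuousOn_regNegTraceMulLog ε.2)).lowerSemicontinuousOn
  exact fun A hA => LowerSemicontinuousWithinAt.congr_of_eventuallyEq (h A hA) hA
    (eventually_nhdsWithin_of_forall fun B hB =>
      (negTraceMulLog_eq_iSup hρ (Matrix.nonneg_iff_posSemidef.1 hB.1)).symm)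

end Semicontinuity

/-! ### Compactness of `ap(S)` and of the state space -/

section Compactness

open scoped MatrixOrder Matrix.Norms.L2Operator

variable {d : ℕ} {S : Submodule ℂ (Matrix (Fin d) (Fin d) ℂ)}

/-- This corner contains every projection, so it bounds `ap(S)`. -/
theorem isConvexCorner_Icc : IsConvexCorner (Set.Icc (0 : Matrix (Fin d) (Fin d) ℂ) 1) where
  subset_posCone := fun _ hA => Matrix.nonneg_iff_posSemidef.1 hA.1
  nonempty := ⟨0, le_rfl, zero_le_one⟩
  isClosed := isClosed_Icc
  convex := convex_Icc 0 1
  hereditary := fun _ _ hB hA hAB =>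
    ⟨Matrix.nonneg_iff_posSemidef.2 hA, (Matrix.le_iff.2 hAB).trans hB.2⟩

theorem isCompact_Icc_zero_one : IsCompact (Set.Icc (0 : Matrix (Fin d) (Fin d) ℂ) 1) := by
  have : ProperSpace (Matrix (Fin d) (Fin d) ℂ) := FiniteDimensional.proper ℝ _
  refine (isCompact_closedBall (0 : Matrix (Fin d) (Fin d) ℂ) 1).of_isClosed_subset isClosed_Icc
    fun A hA => ?_
  rw [mem_closedBall_zero_iff]
  exact (CStarAlgebra.norm_le_one_iff_of_nonneg A hA.1).mpr hA.2

theorem abelianProjections_subset_Icc : abelianProjections S ⊆ Set.Icc 0 1 :=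
  fun _ hP => ⟨hP.1.nonneg, hP.1.le_one⟩

theorem abelianProjectionCorner_subset_Icc : abelianProjectionCorner S ⊆ Set.Icc 0 1 :=
  Set.sInter_subset_of_mem ⟨isConvexCorner_Icc, abelianProjections_subset_Icc⟩

theorem abelianProjections_subset_corner : abelianProjections S ⊆ abelianProjectionCorner S :=
  Set.subset_sInter fun _ h𝒜 => h𝒜.2

theorem isCompact_abelianProjectionCorner : IsCompact (abelianProjectionCorner S) :=
  isCompact_Icc_zero_one.of_isClosed_subset (isConvexCorner_abelianProjectionCorner S).isClosed
    abelianProjectionCorner_subset_Icc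

theorem isLeast_graphEntropy {ρ : Matrix (Fin d) (Fin d) ℂ} (hρ : ρ ∈ states d) :
    IsLeast (negTraceMulLog ρ '' abelianProjectionCorner S) (graphEntropy S ρ) := by
  have hlsc := (lowerSemicontinuousOn_negTraceMulLog hρ.1).mono
    (abelianProjectionCorner_subset_Icc (S := S))
  obtain ⟨A, hA, hmin⟩ := hlsc.exists_isMinOn (isConvexCorner_abelianProjectionCorner S).nonempty
    isCompact_abelianProjectionCorner
  have heq : graphEntropy S ρ = negTraceMulLog ρ A :=
    le_antisymm (iInf₂_le A hA) (le_iInf₂ fun B hB => hmin hB)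
  rw [heq]
  exact ⟨⟨A, hA, rfl⟩, Set.forall_mem_image.2 fun B hB => hmin hB⟩

theorem states_subset_Icc : states d ⊆ Set.Icc 0 1 := by
  intro ρ hρ
  refine ⟨Matrix.nonneg_iff_posSemidef.2 hρ.1, ?_⟩
  have h : ρ ≤ algebraMap ℝ _ 1 := by
    refine le_algebraMap_of_spectrum_le (fun x hx => ?_) hρ.1.1.isSelfAdjoint
    rw [hρ.1.1.spectrum_real_eq_range_eigenvalues] at hx
    obtain ⟨i, rfl⟩ := hx
    have htr := hρ.1.1.trace_eq_sum_eigenvalues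
    have htr' : (1 : ℝ) = ∑ i, hρ.1.1.eigenvalues i := by
      simpa using congrArg Complex.re (hρ.2.symm.trans htr)
    rw [htr']
    exact Finset.single_le_sum (fun j _ => hρ.1.eigenvalues_nonneg j) (Finset.mem_univ i)
  simpa using h

theorem isCompact_states : IsCompact (states d) := by
  refine isCompact_Icc_zero_one.of_isClosed_subset ?_ states_subset_Icc
  exact (isConvexCorner_posCone d).isClosed.inter
    (isClosed_eq (by fun_prop) continuous_const :
      IsClosed {ρ : Matrix (Fin d) (Fin d) ℂ | ρ.trace = 1})

theorem convex_states : Convex ℝ (states d) := by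
  intro A hA B hB a b ha hb hab
  refine ⟨(isConvexCorner_posCone d).convex hA.1 hB.1 ha hb hab, ?_⟩
  rw [Matrix.trace_add, Matrix.trace_smul, Matrix.trace_smul, hA.2, hB.2, ← add_smul, hab, one_smul]

end Compactness

/-! ### Minimax duality between states and abelian projections -/

section Duality

open scoped MatrixOrder Topology

variable {d : ℕ} {S : Submodule ℂ (Matrix (Fin d) (Fin d) ℂ)}

theorem trace_mul_re_nonneg {A B : Matrix (Fin d) (Fin d) ℂ} (hA : A.PosSemidef)
    (hB : B.PosSemidef) : 0 ≤ (A * B).trace.re := by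
  rw [← sum_eigenWeight_mul_eigenvalues hB.1]
  exact Finset.sum_nonneg fun i _ =>
    mul_nonneg (eigenWeight_nonneg hA hB.1 i) (hB.eigenvalues_nonneg i)

theorem rankOne_mem_states (u : EuclideanSpace ℂ (Fin d)) (hu : ‖u‖ = 1) :
    rankOne u u ∈ states d := by
  refine ⟨Matrix.posSemidef_vecMulVec_self_star _, ?_⟩
  have h : inner ℂ u u = (1 : ℂ) := by
    rw [inner_self_eq_norm_sq_to_K, hu]; simp
  rw [EuclideanSpace.inner_eq_star_dotProduct] at h
  rw [rankOne, Matrix.trace_vecMulVec, h]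

theorem states_nonempty (hd : 1 ≤ d) : (states d).Nonempty :=
  ⟨_, rankOne_mem_states (EuclideanSpace.single ⟨0, hd⟩ 1) (by simp)⟩

theorem abelianProjections_nonempty (hd : 1 ≤ d) : (abelianProjections S).Nonempty :=
  ⟨_, rankOne_mem_abelianProjections S (EuclideanSpace.single ⟨0, hd⟩ 1) (by simp)⟩

/-- A Hermitian matrix whose expectation in every state is at least `s` dominates `s • 1`. -/
theorem posSemidef_sub_smul_one {A : Matrix (Fin d) (Fin d) ℂ} (hA : A.IsHermitian) {s : ℝ}
    (h : ∀ ρ ∈ states d, s ≤ (ρ * A).trace.re) : (A - s • 1).PosSemidef := by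
  have h1 : algebraMap ℝ _ s ≤ A := by
    refine algebraMap_le_of_le_spectrum (fun x hx => ?_) hA.isSelfAdjoint
    rw [hA.spectrum_real_eq_range_eigenvalues] at hx
    obtain ⟨i, rfl⟩ := hx
    refine (h _ (rankOne_mem_states (hA.eigenvectorBasis i)
      (hA.eigenvectorBasis.orthonormal.1 i))).trans_eq ?_
    rw [hA.eigenvalues_eq, rankOne, Matrix.vecMulVec_mul, Matrix.trace_vecMulVec, dotProduct_comm,
      Matrix.dotProduct_mulVec]
    rfl
  rw [Algebra.algebraMap_eq_smul_one] at h1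
  exact Matrix.le_iff.1 h1

/-- The minimax theorem for the pairing of states with the abelian projections. -/
theorem exists_state_dual (hd : 1 ≤ d) : ∃ ρ ∈ states d, ∃ s : ℝ,
    (∀ P ∈ abelianProjections S, (ρ * P).trace.re ≤ s) ∧
    ∀ t < s, ∃ A ∈ convexHull ℝ (abelianProjections S), (A - t • 1).PosSemidef := by
  have hcont : Continuous fun p : Matrix (Fin d) (Fin d) ℂ × Matrix (Fin d) (Fin d) ℂ =>
      (p.1 * p.2).trace.re := by fun_prop
  have hposhull : closure (convexHull ℝ (abelianProjections S)) ⊆ Set.Icc 0 1 :=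
    closure_minimal (convexHull_min abelianProjections_subset_Icc (convex_Icc 0 1))
      isConvexCorner_Icc.isClosed
  have hY : IsCompact (closure (convexHull ℝ (abelianProjections S))) :=
    isCompact_Icc_zero_one.of_isClosed_subset isClosed_closure hposhull
  have hYc : Convex ℝ (closure (convexHull ℝ (abelianProjections S))) :=
    (convex_convexHull ℝ _).closure
  obtain ⟨ρ, hρ, B, hB, hsad⟩ := Sion.exists_isSaddlePointOn (X := states d)
    (Y := closure (convexHull ℝ (abelianProjections S)))
    (f := fun ρ A => (ρ * A).trace.re) (states_nonempty hd) convex_states isCompact_states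
    (fun A _ => (hcont.comp
      (by fun_prop : Continuous fun ρ => (ρ, A))).lowerSemicontinuous.lowerSemicontinuousOn _)
    (fun A _ => by
      refine ConvexOn.quasiconvexOn ⟨convex_states, fun x _ y _ a b _ _ _ => le_of_eq ?_⟩
      simp [add_mul])
    hYc ((abelianProjections_nonempty hd).convexHull.closure) hY
    (fun ρ _ => (hcont.comp
      (by fun_prop : Continuous fun A => (ρ, A))).upperSemicontinuous.upperSemicontinuousOn _)
    (fun ρ _ => by
      refine ConcaveOn.quasiconcaveOn ⟨hYc, fun x _ y _ a b _ _ _ => le_of_eq ?_⟩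
      simp [mul_add])
  refine ⟨ρ, hρ, (ρ * B).trace.re, fun P hP => hsad ρ hρ P
    (subset_closure (subset_convexHull ℝ _ hP)), fun t ht => ?_⟩
  -- `B` lies only in the closure of the hull. Since the states are compact, the strict bound holds
  -- uniformly near `B`, hence at some point of the hull itself.
  have hev : ∀ᶠ A in 𝓝 B, ∀ σ ∈ states d, t < (σ * A).trace.re :=
    isCompact_states.eventually_forall_of_forall_eventually fun σ hσ =>
      ((hcont.comp continuous_swap).tendsto (B, σ)).eventually
        (lt_mem_nhds (ht.trans_le (hsad σ hσ B hB)))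
  obtain ⟨A, hA, hAt⟩ := ((mem_closure_iff_frequently.1 hB).and_eventually hev).exists
  have hA1 := hposhull (subset_closure hA)
  exact ⟨A, hA, posSemidef_sub_smul_one (Matrix.nonneg_iff_posSemidef.1 hA1.1).1
    fun σ hσ => (hAt σ hσ).le⟩

end Duality

/-! ### The two inequalities -/

section Main

variable {d : ℕ} {S : Submodule ℂ (Matrix (Fin d) (Fin d) ℂ)}

theorem isConvexCorner_trace_mul_le {ρ : Matrix (Fin d) (Fin d) ℂ} (hρ : ρ.PosSemidef) {s : ℝ}
    (hs : 0 ≤ s) : IsConvexCorner {A | A.PosSemidef ∧ (ρ * A).trace.re ≤ s} where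
  subset_posCone := fun _ hA => hA.1
  nonempty := ⟨0, Matrix.PosSemidef.zero, by simpa using hs⟩
  isClosed := (isConvexCorner_posCone d).isClosed.inter
    (isClosed_le (by fun_prop) continuous_const :
      IsClosed {A : Matrix (Fin d) (Fin d) ℂ | (ρ * A).trace.re ≤ s})
  convex := by
    intro A hA B hB a b ha hb hab
    refine ⟨(isConvexCorner_posCone d).convex hA.1 hB.1 ha hb hab, ?_⟩
    have h : (ρ * (a • A + b • B)).trace.re = a * (ρ * A).trace.re + b * (ρ * B).trace.re := by
      simp [mul_add]
    rw [h]
    calc _ ≤ a * s + b * s := by gcongr; exacts [hA.2, hB.2]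
      _ = s := by rw [← add_mul, hab, one_mul]
  hereditary := by
    intro A B hB hA hAB
    refine ⟨hA, ?_⟩
    have h := trace_mul_re_nonneg hρ hAB
    rw [mul_sub, Matrix.trace_sub, Complex.sub_re] at h
    linarith [hB.2]

/-- Test the colouring against any state, using `Tr(ρP) ≤ 1`. This keeps `χ_f` positive, so its
logarithm is not a default value. -/
theorem one_le_of_mem_fractionalColouringWeights (hd : 1 ≤ d) {t : ℝ}
    (ht : t ∈ fractionalColouringWeights S) : 1 ≤ t := by
  obtain ⟨k, c, P, hc, hP, hge, rfl⟩ := ht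
  obtain ⟨ρ, hρ⟩ := states_nonempty hd
  have h := trace_mul_re_nonneg hρ.1 hge
  have hle : ∀ i, (ρ * P i).trace.re ≤ 1 := fun i => by
    have h1 := trace_mul_re_nonneg hρ.1 (Matrix.le_iff.1 (abelianProjections_subset_Icc (hP i)).2)
    rw [mul_sub, Matrix.trace_sub, Complex.sub_re, mul_one, hρ.2, Complex.one_re] at h1
    linarith
  rw [mul_sub, Matrix.trace_sub, Complex.sub_re, mul_one, hρ.2, Complex.one_re, Finset.mul_sum,
    Matrix.trace_sum, Complex.re_sum] at h
  have h2 : ∑ i, (ρ * c i • P i).trace.re ≤ ∑ i, c i := Finset.sum_le_sum fun i _ => by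
    rw [mul_smul_comm, Matrix.trace_smul, Complex.smul_re, smul_eq_mul]
    exact mul_le_of_le_one_right (hc i).le (hle i)
  linarith

theorem inv_smul_one_mem_abelianProjectionCorner (hd : 1 ≤ d) {t : ℝ}
    (ht : t ∈ fractionalColouringWeights S) :
    t⁻¹ • (1 : Matrix (Fin d) (Fin d) ℂ) ∈ abelianProjectionCorner S := by
  have ht0 : 0 < t := one_pos.trans_le (one_le_of_mem_fractionalColouringWeights hd ht)
  obtain ⟨k, c, P, hc, hP, hge, rfl⟩ := ht
  refine (isConvexCorner_abelianProjectionCorner S).hereditary _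
    ((∑ i, c i)⁻¹ • ∑ i, c i • P i) ?_ (Matrix.PosSemidef.one.smul (inv_pos.2 ht0).le) ?_
  · rw [Finset.smul_sum]
    simp only [smul_smul]
    refine (isConvexCorner_abelianProjectionCorner S).convex.sum_mem
      (fun i _ => mul_nonneg (inv_pos.2 ht0).le (hc i).le) ?_
      (fun i _ => abelianProjections_subset_corner (hP i))
    rw [← Finset.mul_sum, inv_mul_cancel₀ ht0.ne']
  · rw [← smul_sub]
    exact hge.smul (inv_pos.2 ht0).le

theorem negTraceMulLog_smul_one {ρ : Matrix (Fin d) (Fin d) ℂ} (hρ : ρ ∈ states d) {r : ℝ}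
    (hr : 0 < r) : negTraceMulLog ρ (r • 1) = ((-Real.log r : ℝ) : EReal) := by
  rw [negTraceMulLog, if_pos]
  · rw [← Algebra.algebraMap_eq_smul_one, cfc_algebraMap, Algebra.algebraMap_eq_smul_one,
      mul_smul_comm, mul_one, Matrix.trace_smul, hρ.2]
    simp
  · intro x hx
    have hx' : r • x = 0 := by simpa [Matrix.smul_mulVec] using hx
    rw [(smul_eq_zero.1 hx').resolve_left hr.ne']
    exact zero_mem _

theorem one_le_fractionalChromaticNumber (hd : 1 ≤ d) : 1 ≤ fractionalChromaticNumber S :=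
  le_csInf (fractionalColouringWeights_nonempty S) fun _ ht =>
    one_le_of_mem_fractionalColouringWeights hd ht

theorem graphEntropy_le_log_fractionalChromaticNumber (hd : 1 ≤ d)
    {ρ : Matrix (Fin d) (Fin d) ℂ} (hρ : ρ ∈ states d) :
    graphEntropy S ρ ≤ ((Real.log (fractionalChromaticNumber S) : ℝ) : EReal) := by
  have hχ : 0 < fractionalChromaticNumber S :=
    one_pos.trans_le (one_le_fractionalChromaticNumber hd)
  -- The infimum `χ_f` is not known to be attained, so colourings of weight below `exp c` are used
  -- for each `c > log χ_f`.
  refine EReal.le_of_forall_lt_iff_le.1 fun c hc => ?_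
  rw [EReal.coe_lt_coe_iff, Real.log_lt_iff_lt_exp hχ] at hc
  obtain ⟨t, ht, htc⟩ := exists_lt_of_csInf_lt (fractionalColouringWeights_nonempty S) hc
  have ht0 : 0 < t := one_pos.trans_le (one_le_of_mem_fractionalColouringWeights hd ht)
  calc graphEntropy S ρ ≤ negTraceMulLog ρ (t⁻¹ • 1) :=
        iInf₂_le _ (inv_smul_one_mem_abelianProjectionCorner hd ht)
    _ = ((Real.log t : ℝ) : EReal) := by
        rw [negTraceMulLog_smul_one hρ (inv_pos.2 ht0), Real.log_inv, neg_neg]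
    _ ≤ (c : EReal) := EReal.coe_le_coe_iff.2 ((Real.log_lt_iff_lt_exp ht0).2 htc).le

theorem inv_mem_fractionalColouringWeights {A : Matrix (Fin d) (Fin d) ℂ}
    (hA : A ∈ convexHull ℝ (abelianProjections S)) {t : ℝ} (ht : 0 < t)
    (h : (A - t • 1).PosSemidef) : t⁻¹ ∈ fractionalColouringWeights S := by
  -- Carathéodory's form of the hull supplies strictly positive coefficients, as colourings require.
  obtain ⟨ι, _, z, w, hz, -, hw, hw1, rfl⟩ := eq_pos_convex_span_of_mem_convexHull hA
  let e := (Fintype.equivFin ι).symm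
  refine ⟨Fintype.card ι, fun i => t⁻¹ * w (e i), fun i => z (e i),
    fun i => mul_pos (inv_pos.2 ht) (hw _), fun i => hz ⟨_, rfl⟩, ?_, ?_⟩
  · rw [e.sum_comp fun j => (t⁻¹ * w j) • z j]
    have h1 := h.smul (inv_pos.2 ht).le
    rwa [smul_sub, smul_smul, inv_mul_cancel₀ ht.ne', one_smul, Finset.smul_sum,
      Finset.sum_congr rfl fun j _ => smul_smul t⁻¹ (w j) (z j)] at h1
  · rw [e.sum_comp fun j => t⁻¹ * w j, ← Finset.mul_sum, hw1, mul_one]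

theorem exists_log_fractionalChromaticNumber_le_graphEntropy (hd : 1 ≤ d) :
    ∃ ρ ∈ states d, ((Real.log (fractionalChromaticNumber S) : ℝ) : EReal) ≤ graphEntropy S ρ := by
  obtain ⟨ρ, hρ, s, hs, hdual⟩ := exists_state_dual (S := S) hd
  have hχ : 0 < fractionalChromaticNumber S :=
    one_pos.trans_le (one_le_fractionalChromaticNumber hd)
  -- If `s ≤ 0`, pairing `ρ` with any colouring would give a number at most `0`, yet it is at least
  -- `Tr ρ = 1`.
  have hs0 : 0 < s := by
    by_contra! hs0
    obtain ⟨-, k, c, P, hc, hP, hge, -⟩ := fractionalColouringWeights_nonempty S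
    have h := trace_mul_re_nonneg hρ.1 hge
    rw [mul_sub, Matrix.trace_sub, Complex.sub_re, mul_one, hρ.2, Complex.one_re, Finset.mul_sum,
      Matrix.trace_sum, Complex.re_sum] at h
    have h2 : ∑ i, (ρ * c i • P i).trace.re ≤ 0 := Finset.sum_nonpos fun i _ => by
      rw [mul_smul_comm, Matrix.trace_smul, Complex.smul_re, smul_eq_mul]
      exact mul_nonpos_of_nonneg_of_nonpos (hc i).le ((hs _ (hP i)).trans hs0)
    linarith
  have hle : s ≤ (fractionalChromaticNumber S)⁻¹ := by
    refine le_of_forall_lt_imp_le_of_dense fun t ht => ?_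
    rcases le_or_gt t 0 with h0 | h0
    · exact h0.trans (inv_pos.2 hχ).le
    · obtain ⟨A, hA, hAt⟩ := hdual t ht
      rw [le_inv_comm₀ h0 hχ]
      exact csInf_le (fractionalColouringWeights_bddBelow S)
        (inv_mem_fractionalColouringWeights hA h0 hAt)
  have hsub : abelianProjectionCorner S ⊆ {A | A.PosSemidef ∧ (ρ * A).trace.re ≤ s} :=
    Set.sInter_subset_of_mem ⟨isConvexCorner_trace_mul_le hρ.1 hs0.le, fun P hP =>
      ⟨Matrix.nonneg_iff_posSemidef.1 (abelianProjections_subset_Icc hP).1, hs P hP⟩⟩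
  refine ⟨ρ, hρ, le_iInf₂ fun A hA => ?_⟩
  refine le_trans ?_ (neg_log_le_negTraceMulLog hρ (hsub hA).1 hs0 (hsub hA).2)
  rw [EReal.coe_le_coe_iff, le_neg, ← Real.log_inv]
  exact Real.log_le_log hs0 hle

end Main

end NCGraph

theorem mainTheorem10 (d : ℕ) (hd : 1 ≤ d) (S : Submodule ℂ (Matrix (Fin d) (Fin d) ℂ))
    (hS : NCGraph.IsOperatorSystem S) :
    (∀ ρ ∈ NCGraph.states d,
      IsLeast (NCGraph.negTraceMulLog ρ '' NCGraph.abelianProjectionCorner S)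
        (NCGraph.graphEntropy S ρ)) ∧
    IsGreatest (NCGraph.graphEntropy S '' NCGraph.states d)
      ((Real.log (NCGraph.fractionalChromaticNumber S) : ℝ) : EReal) := by
  refine ⟨fun ρ hρ => NCGraph.isLeast_graphEntropy hρ, ?_, ?_⟩
  · obtain ⟨ρ, hρ, h⟩ := NCGraph.exists_log_fractionalChromaticNumber_le_graphEntropy (S := S) hd
    exact ⟨ρ, hρ, (NCGraph.graphEntropy_le_log_fractionalChromaticNumber hd hρ).antisymm h⟩
  · rintro _ ⟨ρ, hρ, rfl⟩
    exact NCGraph.graphEntropy_le_log_fractionalChromaticNumber hd hρ
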